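/- Let $p$ be a prime, let $q$ be a power of $p$, let $d \ge 0$ be an integer, and set $t = \left\lceil \frac{d+1}{q-q/p} \right\rceil$. Let $k \ge t$ and let $f \colon \mathbb{F}_q^{k+1} \to \mathbb{F}_q$ be a function. Here $\deg f$ denotes the least total degree of a polynomial over $\mathbb{F}_q$ representing $f$; a $k$-flat is a $k$-dimensional affine subspace $A$ of $\mathbb{F}_q^{k+1}$; $\deg(f|_A)$ is the least total degree of a polynomial agreeing with $f$ on $A$ (equivalently, the degree of $f|_A$ as a function on $\mathbb{F}_q^k$ under an affine identification $A \cong \mathbb{F}_q^k$); and $\varepsilon_{k,d}(f)$ is the fraction of all $k$-flats $A \subseteq \mathbb{F}_q^{k+1}$ for which $\deg(f|_A) > d$. Then: 1. If $\deg f > d$, then $\varepsilon_{k,d}(f) \ge \frac{1}{q}$. 2. If $d < \deg f < (k+1)(q-1)$, then $\varepsilon_{k,d}(f) > \frac{1}{q}$. -/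

import Mathlib

namespace FlatTest

open MvPolynomial

variable {F : Type*} [Field F]

/-- The degree of the restriction `f|_S` of a function `f : F^n → F` to a set `S` of points: the least
total degree of a polynomial that agrees with `f` on `S`. -/
noncomputable def degOn {n : ℕ} (f : (Fin n → F) → F) (S : Set (Fin n → F)) : ℕ :=
  sInf {m : ℕ | ∃ P : MvPolynomial (Fin n) F, P.totalDegree = m ∧ ∀ x ∈ S, eval x P = f x}

/-- The degree of a function `f : F^n → F`: the least total degree of a polynomial representing `f`. -/
noncomputable def deg {n : ℕ} (f : (Fin n → F) → F) : ℕ := degOn f Set.univ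

/-- The `k`-flats of `F^n`: the (nonempty) affine subspaces of dimension `k`. -/
def flats (F : Type*) [Field F] (n k : ℕ) : Set (AffineSubspace F (Fin n → F)) :=
  {A | (A : Set (Fin n → F)).Nonempty ∧ Module.finrank F A.direction = k}

/-- The rejection probability of the `k`-flat test for degree `d`: the fraction of the `k`-flats `A` of
`F^n` for which `f|_A` has degree larger than `d`. -/
noncomputable def rejProb {n : ℕ} (k d : ℕ) (f : (Fin n → F) → F) : ℝ :=
  ({A ∈ flats F n k | d < degOn f (A : Set (Fin n → F))}.ncard : ℝ) / ((flats F n k).ncard : ℝ)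

/-- Over a finite field every function is represented by a polynomial, so `degOn` is a genuine minimum. -/
theorem exists_poly [Finite F] {n : ℕ} (f : (Fin n → F) → F) :
    ∃ P : MvPolynomial (Fin n) F, ∀ x, eval x P = f x := by
  classical
  have := Fintype.ofFinite F
  have h := MvPolynomial.map_restrict_dom_evalₗ F (Fin n)
  have hf : f ∈ (restrictDegree (Fin n) F (Fintype.card F - 1)).map (evalₗ F (Fin n)) := by
    rw [h]; trivial
  obtain ⟨P, -, hP⟩ := hf
  exact ⟨P, fun x => congrFun hP x⟩

theorem degOn_le_iff [Finite F] {n : ℕ} (f : (Fin n → F) → F) (S : Set (Fin n → F)) (m : ℕ) :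
    degOn f S ≤ m ↔ ∃ P : MvPolynomial (Fin n) F, P.totalDegree ≤ m ∧ ∀ x ∈ S, eval x P = f x := by
  constructor
  · intro h
    obtain ⟨P, hP⟩ := exists_poly f
    obtain ⟨Q, hQ, hQS⟩ := Nat.sInf_mem (s := {m : ℕ | ∃ P : MvPolynomial (Fin n) F,
      P.totalDegree = m ∧ ∀ x ∈ S, eval x P = f x}) ⟨_, P, rfl, fun x _ => hP x⟩
    exact ⟨Q, hQ.le.trans h, hQS⟩
  · rintro ⟨P, hP, hPS⟩
    have h : degOn f S ≤ P.totalDegree := Nat.sInf_le ⟨P, rfl, hPS⟩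
    exact h.trans hP

/-- Composing a polynomial with an affine map does not raise its degree. -/
theorem exists_comp_affine {m n : ℕ} (φ : (Fin m → F) →ᵃ[F] (Fin n → F))
    (P : MvPolynomial (Fin n) F) :
    ∃ Q : MvPolynomial (Fin m) F, Q.totalDegree ≤ P.totalDegree ∧
      ∀ x, eval x Q = eval (φ x) P := by
  let L : Fin n → MvPolynomial (Fin m) F := fun i =>
    ∑ j, C (φ.linear (Pi.single j 1) i) * X j + C (φ 0 i)
  have hL : ∀ i, (L i).totalDegree ≤ 1 := by
    intro i
    refine (totalDegree_add _ _).trans (max_le ?_ (by simp))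
    refine totalDegree_finsetSum_le fun j _ => ?_
    exact (totalDegree_mul _ _).trans (by simp)
  have hev : ∀ x i, eval x (L i) = φ x i := by
    intro x i
    have h1 : φ x = φ.linear x + φ 0 := congrFun φ.decomp x
    have h2 : φ.linear x = ∑ j, x j • φ.linear (Pi.single j 1) := by
      conv_lhs => rw [pi_eq_sum_univ' x]
      rw [map_sum]
      refine Finset.sum_congr rfl fun j _ => ?_
      rw [← map_smul]
    rw [h1, h2]
    simp [L, mul_comm]
  refine ⟨bind₁ L P, ?_, fun x => ?_⟩
  · rw [← aeval_eq_bind₁, aeval_def, eval₂_eq]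
    refine totalDegree_finsetSum_le fun s hs => ?_
    refine (totalDegree_mul _ _).trans ?_
    have h0 : (algebraMap F (MvPolynomial (Fin m) F) (coeff s P)).totalDegree = 0 :=
      totalDegree_C _
    rw [h0, zero_add]
    refine (totalDegree_finsetProd _ _).trans ?_
    refine le_trans (Finset.sum_le_sum fun i _ => ?_) (le_totalDegree hs)
    exact (totalDegree_pow _ _).trans (by simpa using Nat.mul_le_mul_left (s i) (hL i))
  · rw [← aeval_eq_bind₁, aeval_def, eval_eval₂]
    have : (eval x).comp (algebraMap F (MvPolynomial (Fin m) F)) = RingHom.id F := by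
      ext a; simp [algebraMap_eq]
    rw [this]
    simp only [hev]
    rfl

/-- The degree of `f|_A` is the degree of `f ∘ φ` for every affine parametrization `φ` of the flat `A`. -/
theorem degOn_eq_deg_comp [Finite F] {m n : ℕ} (f : (Fin n → F) → F)
    (φ : (Fin m → F) →ᵃ[F] (Fin n → F)) (hφ : Function.Injective φ) :
    degOn f (Set.range φ) = deg (f ∘ φ) := by
  apply le_antisymm
  · rw [degOn_le_iff]
    obtain ⟨P, hP, hPf⟩ := (degOn_le_iff (f ∘ φ) Set.univ _).1 le_rfl
    have hlin : Function.Injective φ.linear := (AffineMap.linear_injective_iff φ).2 hφ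
    obtain ⟨g, hg⟩ := LinearMap.exists_leftInverse_of_injective φ.linear
      (LinearMap.ker_eq_bot.2 hlin)
    let ψ : (Fin n → F) →ᵃ[F] (Fin m → F) :=
      g.toAffineMap - AffineMap.const F (Fin n → F) (g (φ 0))
    have hψ : ∀ x, ψ (φ x) = x := by
      intro x
      have h1 : φ x = φ.linear x + φ 0 := congrFun φ.decomp x
      have h2 : g (φ.linear x) = x := LinearMap.congr_fun hg x
      simp [ψ, h1, h2]
    obtain ⟨Q, hQ, hQe⟩ := exists_comp_affine ψ P
    refine ⟨Q, hQ.trans hP, ?_⟩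
    rintro _ ⟨x, rfl⟩
    rw [hQe, hψ, hPf x trivial]
    rfl
  · rw [deg, degOn_le_iff]
    obtain ⟨P, hP, hPf⟩ := (degOn_le_iff f (Set.range φ) _).1 le_rfl
    obtain ⟨Q, hQ, hQe⟩ := exists_comp_affine φ P
    exact ⟨Q, hQ.trans hP, fun x _ => by rw [hQe, hPf _ ⟨x, rfl⟩]; rfl⟩

end FlatTest

/-! Call a hyperplane bad if f restricted to it has degree more than d. The proof first bounds the
number of bad hyperplanes transversal to a fixed direction, then averages over the directions inside
one bad hyperplane.

Let P be the reduced polynomial of f and m a monomial of top degree. On the graph x₀ = z₀ + ∑ zᵢxᵢ,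
each coefficient of the reduced restriction is a polynomial in z of degree at most q - 1. Base-p
digits of m₀ are moved greedily onto the other exponents, which keeps a multinomial coefficient
prime to p (`exists_distribution`). This ends either with no loss of degree or with all k exponents
at least q - q/p; since k(q - q/p) > d, the resulting monomial e has degree above d in both cases.
The coefficient of e is a nonzero polynomial G in z (`exists_witness`), because maximality of m
rules out cancellation. By Schwartz–Zippel at least q^k of the q^(k+1) graphs are bad, and a linear
change of coordinates gives this for every direction (`card_transversal_ge`).

Now fix l ≠ 0 with c bad hyperplanes among its translates. Counting pairs (nonzero v in ker l, bad
hyperplane transversal to v) bounds the bad hyperplanes not parallel to ker l; adding the c parallel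
ones yields at least q^(k+1) - q + (q - 1)c bad equations out of (q^(k+1) - 1)q (`card_bad_ge`). One
bad hyperplane, c ≥ 1, gives 1/q. Strictness needs c ≥ 2: below the maximal degree some exponent of
m is less than q - 1, and taking that variable as x₀ makes the sum of G over z₀ vanish, so nonzeros
of G come at least in pairs along z₀ (`exists_two`). -/

namespace FlatTest

open MvPolynomial

variable {F : Type*} [Field F]

/-! ### Reduction of polynomials modulo x^q - x -/

/-- The exponent in `[0, q - 1]` defining the same power function as `u` on a field with `q`
elements. -/
def redExp (q u : ℕ) : ℕ := if u = 0 then 0 else (u - 1) % (q - 1) + 1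

theorem redExp_zero (q : ℕ) : redExp q 0 = 0 := if_pos rfl

theorem redExp_le_self (q u : ℕ) : redExp q u ≤ u := by
  unfold redExp
  split_ifs with h
  · omega
  · have := Nat.mod_le (u - 1) (q - 1)
    omega

theorem redExp_le {q : ℕ} (hq : 1 < q) (u : ℕ) : redExp q u ≤ q - 1 := by
  unfold redExp
  split_ifs with h
  · omega
  · have := Nat.mod_lt (u - 1) (show q - 1 > 0 by omega)
    omega

theorem redExp_of_le {q u : ℕ} (hu : u ≤ q - 1) : redExp q u = u := by
  unfold redExp
  split_ifs with h
  · exact h.symm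
  · rw [Nat.mod_eq_of_lt (by omega)]
    omega

theorem pow_redExp [Fintype F] (x : F) (u : ℕ) : x ^ redExp (Fintype.card F) u = x ^ u := by
  unfold redExp
  split_ifs with h
  · rw [h]
  · by_cases hx : x = 0
    · rw [hx, zero_pow h, zero_pow (by omega)]
    · have h1 := Nat.div_add_mod (u - 1) (Fintype.card F - 1)
      have h2 : u = (Fintype.card F - 1) * ((u - 1) / (Fintype.card F - 1)) +
          ((u - 1) % (Fintype.card F - 1) + 1) := by omega
      conv_rhs => rw [h2]
      rw [pow_add _ (_ * _), pow_mul, FiniteField.pow_card_sub_one_eq_one x hx, one_pow, one_mul]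

/-- Entrywise reduction of an exponent vector. -/
noncomputable def redMon (q : ℕ) {σ : Type*} (m : σ →₀ ℕ) : σ →₀ ℕ :=
  m.mapRange (redExp q) (redExp_zero q)

theorem redMon_apply (q : ℕ) {σ : Type*} (m : σ →₀ ℕ) (i : σ) :
    redMon q m i = redExp q (m i) := rfl

theorem degree_redMon_le (q : ℕ) {n : ℕ} (m : Fin n →₀ ℕ) : (redMon q m).degree ≤ m.degree := by
  rw [Finsupp.degree_eq_sum, Finsupp.degree_eq_sum]
  exact Finset.sum_le_sum fun i _ => redExp_le_self q (m i)

/-- The reduced form of a polynomial over a field with `q` elements. -/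
noncomputable def red (q : ℕ) (n : ℕ) :
    MvPolynomial (Fin n) F →ₗ[F] MvPolynomial (Fin n) F :=
  (basisMonomials (Fin n) F).constr F fun m => monomial (redMon q m) 1

theorem red_monomial (q : ℕ) {n : ℕ} (m : Fin n →₀ ℕ) (c : F) :
    red q n (monomial m c) = monomial (redMon q m) c := by
  have h : monomial m c = c • basisMonomials (Fin n) F m := by
    simp [smul_monomial]
  rw [h, map_smul, red, Module.Basis.constr_basis, smul_monomial]
  simp

theorem red_eq_sum (q : ℕ) {n : ℕ} (P : MvPolynomial (Fin n) F) :
    red q n P = ∑ m ∈ P.support, monomial (redMon q m) (coeff m P) := by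
  conv_lhs => rw [P.as_sum, map_sum]
  exact Finset.sum_congr rfl fun m _ => red_monomial q m _

theorem eval_red [Fintype F] {n : ℕ} (P : MvPolynomial (Fin n) F) (x : Fin n → F) :
    eval x (red (Fintype.card F) n P) = eval x P := by
  conv_rhs => rw [P.as_sum]
  rw [red_eq_sum, map_sum, map_sum]
  refine Finset.sum_congr rfl fun m _ => ?_
  rw [eval_monomial, eval_monomial, Finsupp.prod_fintype _ _ (by simp),
    Finsupp.prod_fintype _ _ (by simp)]
  simp only [redMon_apply, pow_redExp]

theorem exists_of_mem_support_red {q n : ℕ} {P : MvPolynomial (Fin n) F} {e : Fin n →₀ ℕ}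
    (he : e ∈ (red q n P).support) : ∃ m ∈ P.support, redMon q m = e := by
  classical
  rw [red_eq_sum] at he
  obtain ⟨m, hm, h⟩ := Finset.mem_biUnion.1 (support_sum he)
  exact ⟨m, hm, (Finset.mem_singleton.1 (support_monomial_subset h)).symm⟩

theorem totalDegree_red_le (q : ℕ) {n : ℕ} (P : MvPolynomial (Fin n) F) :
    (red q n P).totalDegree ≤ P.totalDegree := by
  refine Finset.sup_le fun e he => ?_
  obtain ⟨m, hm, rfl⟩ := exists_of_mem_support_red he
  exact (degree_redMon_le q m).trans (le_totalDegree hm)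

/-- The difference of the reduced forms has degree below q in each variable and vanishes on all of
F^n, hence is zero. -/
theorem red_eq_of_eval_eq [Fintype F] {n : ℕ} {P Q : MvPolynomial (Fin n) F}
    (h : ∀ x, eval x P = eval x Q) :
    red (Fintype.card F) n P = red (Fintype.card F) n Q := by
  classical
  rw [← sub_eq_zero, ← map_sub]
  refine eq_zero_of_eval_zero_at_prod_finset _ (fun _ => Finset.univ) (fun i => ?_) fun x _ => ?_
  · rw [Finset.card_univ]
    rw [degreeOf_lt_iff Fintype.card_pos]
    intro e he
    obtain ⟨m, -, rfl⟩ := exists_of_mem_support_red he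
    have := redExp_le (q := Fintype.card F) Fintype.one_lt_card (m i)
    have := Fintype.one_lt_card (α := F)
    rw [redMon_apply]
    omega
  · rw [eval_red, map_sub, h, sub_self]

/-- Certificate for large degree: one nonzero coefficient of degree above d in the reduced form of
any representative excludes degree at most d. -/
theorem coeff_red_eq_zero [Fintype F] {n d : ℕ} {g : (Fin n → F) → F} (hg : deg g ≤ d)
    {P : MvPolynomial (Fin n) F} (hP : ∀ x, eval x P = g x) {e : Fin n →₀ ℕ} (he : d < e.degree) :
    coeff e (red (Fintype.card F) n P) = 0 := by
  obtain ⟨Q, hQ, hQg⟩ := (degOn_le_iff g Set.univ d).1 hg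
  rw [red_eq_of_eval_eq (Q := Q) fun x => by rw [hP, hQg x trivial]]
  by_contra h
  have := le_totalDegree (mem_support_iff.2 h)
  have := totalDegree_red_le (Fintype.card F) Q
  simp only [Finsupp.degree_apply, Finsupp.sum] at *
  omega

/-- Every function on `F^n` is represented by a polynomial with exponents at most `q - 1` whose total
degree is the degree of the function. -/
theorem exists_reduced_poly [Fintype F] {n : ℕ} (f : (Fin n → F) → F) :
    ∃ P : MvPolynomial (Fin n) F, (∀ x, eval x P = f x) ∧ P.totalDegree = deg f ∧
      ∀ m ∈ P.support, ∀ i, m i ≤ Fintype.card F - 1 := by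
  obtain ⟨Q, hQ, hQf⟩ := (degOn_le_iff f Set.univ _).1 le_rfl
  have hev : ∀ x, eval x (red (Fintype.card F) n Q) = f x := fun x => by
    rw [eval_red, hQf x trivial]
  refine ⟨red (Fintype.card F) n Q, hev, le_antisymm ((totalDegree_red_le _ _).trans hQ) ?_, ?_⟩
  · exact (degOn_le_iff f Set.univ _).2 ⟨_, le_rfl, fun x _ => hev x⟩
  · intro e he i
    obtain ⟨m, -, rfl⟩ := exists_of_mem_support_red he
    exact redExp_le Fintype.one_lt_card _

/-! ### Multinomial coefficients modulo p and moving digits -/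

/-- A prime does not divide the binomial coefficient that extracts a leading base-`p` digit. -/
theorem not_dvd_choose_pow {p : ℕ} (hp : p.Prime) (s : ℕ) :
    ∀ n, p ^ s ≤ n → n < p ^ (s + 1) → ¬ p ∣ n.choose (p ^ s) := by
  have := Fact.mk hp
  induction s with
  | zero =>
    intro n h1 h2 h
    rw [pow_zero, Nat.choose_one_right] at h
    have := Nat.le_of_dvd (Nat.lt_of_lt_of_le Nat.zero_lt_one h1) h
    rw [zero_add, pow_one] at h2
    omega
  | succ s ih =>
    intro n h1 h2 h
    -- Lucas: dropping the last base-p digit leaves the binomial coefficient unchanged mod p, as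
    -- that digit of p^(s+1) is 0.
    have hL := Choose.choose_modEq_choose_mod_mul_choose_div_nat (n := n) (k := p ^ (s + 1)) (p := p)
    rw [pow_succ, Nat.mul_mod_left, Nat.choose_zero_right, one_mul,
      Nat.mul_div_cancel _ hp.pos, ← pow_succ] at hL
    refine ih (n / p) ?_ ?_ ((hL.dvd_iff dvd_rfl).1 h)
    · rw [Nat.le_div_iff_mul_le hp.pos, ← pow_succ]
      exact h1
    · rw [Nat.div_lt_iff_lt_mul hp.pos, ← pow_succ]
      exact h2

theorem sum_move {ι : Type*} [Fintype ι] [DecidableEq ι] (w : ι → ℕ) {i j : ι} (hij : i ≠ j)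
    {u : ℕ} (hu : u ≤ w i) :
    ∑ a, Function.update (Function.update w i (w i - u)) j (w j + u) a = ∑ a, w a := by
  have hji : j ∈ Finset.univ.erase i := by simp [hij.symm]
  have ho : ∀ a ∈ (Finset.univ.erase i).erase j,
      Function.update (Function.update w i (w i - u)) j (w j + u) a = w a := by
    intro a ha
    simp only [Finset.mem_erase, Finset.mem_univ, and_true] at ha
    simp [ha.1, ha.2]
  rw [← Finset.add_sum_erase _ _ (Finset.mem_univ i), ← Finset.add_sum_erase _ _ hji,
    ← Finset.add_sum_erase _ w (Finset.mem_univ i), ← Finset.add_sum_erase _ w hji,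
    Finset.sum_congr rfl ho, Function.update_self, Function.update_of_ne hij,
    Function.update_self]
  linarith [Nat.sub_add_cancel hu]

/-- Moving `u` units from one part to another keeps a multinomial coefficient prime to `p`,
provided the corresponding binomial coefficient is. -/
theorem not_dvd_multinomial_move {ι : Type*} [Fintype ι] [DecidableEq ι] {p : ℕ} (hp : p.Prime)
    (w : ι → ℕ) {i j : ι} (hij : i ≠ j) {u : ℕ} (hu : u ≤ w i)
    (hw : ¬ p ∣ Nat.multinomial Finset.univ w) (hc : ¬ p ∣ (w i).choose u) :
    ¬ p ∣ Nat.multinomial Finset.univ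
      (Function.update (Function.update w i (w i - u)) j (w j + u)) := by
  set w' := Function.update (Function.update w i (w i - u)) j (w j + u) with hw'
  have hi : w' i = w i - u := by simp [w', hij]
  have hj : w' j = w j + u := by simp [w']
  have ho : ∀ a ∈ (Finset.univ.erase i).erase j, w' a = w a := by
    intro a ha
    simp only [Finset.mem_erase, Finset.mem_univ, and_true] at ha
    simp [w', ha.1, ha.2]
  have hji : j ∈ Finset.univ.erase i := by simp [hij.symm]
  have hsum : ∑ a, w' a = ∑ a, w a := sum_move w hij hu
  have h1 := Nat.multinomial_spec Finset.univ w
  have h2 := Nat.multinomial_spec Finset.univ w'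
  rw [hsum, ← h1, ← Finset.mul_prod_erase _ _ (Finset.mem_univ i), ← Finset.mul_prod_erase _ _ hji,
    ← Finset.mul_prod_erase _ _ (Finset.mem_univ i), ← Finset.mul_prod_erase _ _ hji,
    Finset.prod_congr rfl fun a ha => congrArg Nat.factorial (ho a ha), hi, hj] at h2
  set R := ∏ a ∈ (Finset.univ.erase i).erase j, (w a).factorial with hR
  have hRpos : 0 < R := Finset.prod_pos fun a _ => Nat.factorial_pos _
  have h3 := Nat.choose_mul_factorial_mul_factorial hu
  have h4 := Nat.choose_mul_factorial_mul_factorial (Nat.le_add_left u (w j))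
  rw [Nat.add_sub_cancel] at h4
  -- Both multinomials times their factorials equal (∑ w)!; the common factors cancel.
  have key : Nat.multinomial Finset.univ w' * (w j + u).choose u =
      Nat.multinomial Finset.univ w * (w i).choose u := by
    have hpos : 0 < (w i - u).factorial * (w j).factorial * u.factorial * R := by positivity
    refine Nat.eq_of_mul_eq_mul_right hpos ?_
    rw [← h3, ← h4] at h2
    linear_combination h2
  intro h
  rcases (hp.dvd_mul).1 (key ▸ Dvd.dvd.mul_right h _) with h | h
  · exact hw h
  · exact hc h

/-- The base-`p` digits of `w 0` can be distributed over the other parts, without exceeding `p ^ r - 1`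
when added to `I`, until `w 0` is exhausted or all these parts are at least `p ^ r - p ^ (r - 1)`. -/
theorem exists_distribution {p r k : ℕ} (hp : p.Prime) (I : Fin k → ℕ) :
    ∀ (N : ℕ) (w : Fin (k + 1) → ℕ), w 0 = N → w 0 < p ^ r → ¬ p ∣ Nat.multinomial Finset.univ w →
      (∀ i, I i + w i.succ < p ^ r) →
      ∃ w' : Fin (k + 1) → ℕ, ∑ i, w' i = ∑ i, w i ∧ ¬ p ∣ Nat.multinomial Finset.univ w' ∧
        (∀ i, I i + w' i.succ < p ^ r) ∧
        (w' 0 = 0 ∨ ∀ i, p ^ r - p ^ (r - 1) ≤ I i + w' i.succ) := by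
  intro N
  induction N using Nat.strong_induction_on with
  | _ N ih =>
    intro w hN hwr hw hI
    by_cases h0 : w 0 = 0
    · exact ⟨w, rfl, hw, hI, Or.inl h0⟩
    -- The unit to move is the leading power p^s of w 0. If it fits nowhere, every part is already
    -- at least p^r - p^s, and s ≤ r - 1.
    set s := Nat.log p (w 0) with hs
    have hs1 : p ^ s ≤ w 0 := Nat.pow_log_le_self p h0
    have hs2 : w 0 < p ^ (s + 1) := Nat.lt_pow_succ_log_self hp.one_lt _
    have hsr : s ≤ r - 1 := by
      have : s < r := (Nat.pow_lt_pow_iff_right hp.one_lt).1 (hs1.trans_lt hwr)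
      omega
    have hle : p ^ s ≤ p ^ (r - 1) := Nat.pow_le_pow_right hp.pos hsr
    by_cases hfit : ∃ i, I i + w i.succ + p ^ s < p ^ r
    · obtain ⟨i, hi⟩ := hfit
      have hne : (0 : Fin (k + 1)) ≠ i.succ := (Fin.succ_ne_zero i).symm
      set w1 := Function.update (Function.update w 0 (w 0 - p ^ s)) i.succ (w i.succ + p ^ s)
        with hw1
      have e0 : w1 0 = w 0 - p ^ s := by simp [w1, hne]
      have hps : 0 < p ^ s := Nat.pow_pos hp.pos
      have hsum : ∑ a, w1 a = ∑ a, w a := sum_move w hne hs1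
      obtain ⟨w', h1, h2, h3, h4⟩ := ih (w1 0) (by omega) w1 rfl (by omega)
        (not_dvd_multinomial_move hp w hne hs1 hw (not_dvd_choose_pow hp s _ hs1 hs2)) (by
          intro j
          by_cases hj : j = i
          · subst hj
            simp only [w1, Function.update_self]
            omega
          · have : w1 j.succ = w j.succ := by simp [w1, hj]
            rw [this]
            exact hI j)
      exact ⟨w', h1.trans hsum, h2, h3, h4⟩
    · push Not at hfit
      refine ⟨w, rfl, hw, hI, Or.inr fun i => ?_⟩
      have := hfit i
      omega

/-! ### Restriction to graph hyperplanes -/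

/-- The polynomial `P (z 0 + ∑ i, z (i + 1) * X i, X)` in the variables `X`. -/
noncomputable def graphPoly {k : ℕ} (P : MvPolynomial (Fin (k + 1)) F) (z : Fin (k + 1) → F) :
    MvPolynomial (Fin k) F :=
  ∑ m ∈ P.support, ∑ w ∈ Finset.univ.piAntidiag (m 0),
    monomial (m.tail + (Finsupp.equivFunOnFinite.symm w).tail)
      (coeff m P * (Nat.multinomial Finset.univ w : F) * ∏ i, z i ^ w i)

theorem eval_graphPoly {k : ℕ} (P : MvPolynomial (Fin (k + 1)) F) (z : Fin (k + 1) → F)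
    (x : Fin k → F) :
    eval x (graphPoly P z) = eval (Fin.cons (z 0 + ∑ i, z i.succ * x i) x) P := by
  have h : z 0 + ∑ i : Fin k, z i.succ * x i = ∑ i, z i * (Fin.cons 1 x : Fin (k + 1) → F) i := by
    rw [Fin.sum_univ_succ]
    simp
  rw [eval_eq' _ P, graphPoly, map_sum]
  refine Finset.sum_congr rfl fun m _ => ?_
  rw [Fin.prod_univ_succ, Fin.cons_zero, h, Finset.sum_pow_eq_sum_piAntidiag, map_sum,
    Finset.sum_mul, Finset.mul_sum]
  refine Finset.sum_congr rfl fun w _ => ?_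
  rw [eval_monomial, Finsupp.prod_fintype _ _ (by simp)]
  simp only [mul_pow, Finset.prod_mul_distrib, Finsupp.add_apply, pow_add, Finsupp.tail_apply,
    Fin.cons_succ]
  rw [Fin.prod_univ_succ (fun i => (Fin.cons 1 x : Fin (k + 1) → F) i ^ w i)]
  simp only [Fin.cons_zero, Fin.cons_succ, one_pow, one_mul, Finsupp.equivFunOnFinite_symm_apply_apply]
  ring

/-- The coefficient of the monomial `e` in the reduced form of `graphPoly P z`, as a polynomial in
`z`. -/
noncomputable def coeffPoly (q : ℕ) {k : ℕ} (P : MvPolynomial (Fin (k + 1)) F) (e : Fin k →₀ ℕ) :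
    MvPolynomial (Fin (k + 1)) F :=
  ∑ m ∈ P.support, ∑ w ∈ Finset.univ.piAntidiag (m 0),
    if redMon q (m.tail + (Finsupp.equivFunOnFinite.symm w).tail) = e then
      monomial (Finsupp.equivFunOnFinite.symm w) (coeff m P * (Nat.multinomial Finset.univ w : F))
    else 0

theorem eval_coeffPoly (q : ℕ) {k : ℕ} (P : MvPolynomial (Fin (k + 1)) F) (e : Fin k →₀ ℕ)
    (z : Fin (k + 1) → F) :
    eval z (coeffPoly q P e) = coeff e (red q k (graphPoly P z)) := by
  classical
  simp only [coeffPoly, graphPoly, map_sum, red_monomial, coeff_sum, coeff_monomial]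
  refine Finset.sum_congr rfl fun m _ => Finset.sum_congr rfl fun w _ => ?_
  split_ifs with h
  · rw [eval_monomial, Finsupp.prod_fintype _ _ (by simp)]
    rfl
  · simp

theorem coeff_coeffPoly (q : ℕ) {k : ℕ} (P : MvPolynomial (Fin (k + 1)) F) (e : Fin k →₀ ℕ)
    (v : Fin (k + 1) →₀ ℕ) :
    coeff v (coeffPoly q P e) =
      ∑ m ∈ P.support with m 0 = v.degree ∧ redMon q (m.tail + v.tail) = e,
        coeff m P * (Nat.multinomial Finset.univ v : F) := by
  classical
  rw [Finset.sum_filter, coeffPoly, coeff_sum]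
  refine Finset.sum_congr rfl fun m _ => ?_
  rw [coeff_sum]
  have hv : ∀ w : Fin (k + 1) → ℕ, Finsupp.equivFunOnFinite.symm w = v ↔ w = v := by
    intro w
    rw [Equiv.symm_apply_eq]
    rfl
  by_cases h0 : m 0 = v.degree
  · rw [Finset.sum_eq_single (v : Fin (k + 1) → ℕ)]
    · have : Finsupp.equivFunOnFinite.symm (v : Fin (k + 1) → ℕ) = v := (hv _).2 rfl
      rw [this]
      simp only [h0, true_and]
      split_ifs <;> simp
    · intro w _ hw
      split_ifs
      · rw [coeff_monomial, if_neg (mt (hv w).1 hw)]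
      · simp
    · intro h
      exact absurd (Finset.mem_piAntidiag.2 ⟨by rw [h0, Finsupp.degree_eq_sum], by simp⟩) h
  · rw [if_neg (fun h => h0 h.1)]
    refine Finset.sum_eq_zero fun w hw => ?_
    split_ifs
    · rw [coeff_monomial, if_neg]
      intro h
      rw [hv] at h
      subst h
      exact h0 ((Finset.mem_piAntidiag.1 hw).1.symm.trans (Finsupp.degree_eq_sum v).symm)
    · simp

theorem exists_of_mem_support_coeffPoly {q k : ℕ} {P : MvPolynomial (Fin (k + 1)) F}
    {e : Fin k →₀ ℕ} {v : Fin (k + 1) →₀ ℕ} (hv : v ∈ (coeffPoly q P e).support) :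
    ∃ m ∈ P.support, m 0 = v.degree ∧ redMon q (m.tail + v.tail) = e := by
  rw [mem_support_iff, coeff_coeffPoly] at hv
  obtain ⟨m, hm, -⟩ := Finset.exists_ne_zero_of_sum_ne_zero hv
  rw [Finset.mem_filter] at hm
  exact ⟨m, hm⟩

theorem degree_eq_add_degree_tail {k : ℕ} (m : Fin (k + 1) →₀ ℕ) :
    m.degree = m 0 + m.tail.degree := by
  rw [Finsupp.degree_eq_sum, Finsupp.degree_eq_sum, Fin.sum_univ_succ]
  rfl

/-- The hyperplane `x 0 = z 0 + ∑ i, z (i + 1) * x (i + 1)`. -/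
def graphSet {k : ℕ} (z : Fin (k + 1) → F) : Set (Fin (k + 1) → F) :=
  {x | x 0 = z 0 + ∑ i : Fin k, z i.succ * x i.succ}

/-- Parametrizing the graph by its last k coordinates turns the restriction into `graphPoly P z`,
whose reduced coefficient at e would vanish if the degree were at most d. -/
theorem lt_degOn_graphSet [Fintype F] {k d : ℕ} {f : (Fin (k + 1) → F) → F}
    {P : MvPolynomial (Fin (k + 1)) F} (hP : ∀ x, eval x P = f x) {e : Fin k →₀ ℕ}
    (he : d < e.degree) {z : Fin (k + 1) → F}
    (hz : eval z (coeffPoly (Fintype.card F) P e) ≠ 0) : d < degOn f (graphSet z) := by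
  by_contra! h
  obtain ⟨Q, hQ, hQf⟩ := (degOn_le_iff f _ d).1 h
  let φ : (Fin k → F) →ᵃ[F] (Fin (k + 1) → F) :=
    { toFun := fun x => Fin.cons (z 0 + ∑ i, z i.succ * x i) x
      linear :=
        { toFun := fun x => Fin.cons (∑ i, z i.succ * x i) x
          map_add' := fun x y => by
            ext j
            refine Fin.cases ?_ (fun i => ?_) j
            · simp [mul_add, Finset.sum_add_distrib]
            · simp
          map_smul' := fun c x => by
            ext j
            refine Fin.cases ?_ (fun i => ?_) j
            · simp [Finset.mul_sum, mul_left_comm]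
            · simp }
      map_vadd' := fun x y => by
        ext j
        refine Fin.cases ?_ (fun i => ?_) j
        · simp [mul_add, Finset.sum_add_distrib]
          ring
        · simp }
  have hφ : ∀ x, φ x = Fin.cons (z 0 + ∑ i, z i.succ * x i) x := fun x => rfl
  obtain ⟨R, hR, hRe⟩ := exists_comp_affine φ Q
  refine hz ?_
  rw [eval_coeffPoly]
  refine coeff_red_eq_zero (g := fun x => eval x (graphPoly P z)) (d := d) ?_ (fun x => rfl) he
  refine (degOn_le_iff _ _ _).2 ⟨R, hR.trans hQ, fun x _ => ?_⟩
  rw [hRe, hQf, eval_graphPoly, hP, hφ]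
  rw [hφ]
  simp [graphSet]

/-- The polynomial in the parameters `z` whose nonvanishing witnesses that the restriction to
`graphSet z` has large degree. -/
theorem exists_witness [Fintype F] {p r k d : ℕ} (hp : p.Prime) (hF : Fintype.card F = p ^ r)
    (hd : d < k * (p ^ r - p ^ (r - 1))) {f : (Fin (k + 1) → F) → F}
    {P : MvPolynomial (Fin (k + 1)) F} (hP : ∀ x, eval x P = f x)
    (hred : ∀ m ∈ P.support, ∀ i, m i ≤ Fintype.card F - 1)
    {m : Fin (k + 1) →₀ ℕ} (hm : m ∈ P.support) (hmax : m.degree = P.totalDegree)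
    (hdm : d < m.degree) :
    ∃ G : MvPolynomial (Fin (k + 1)) F, G ≠ 0 ∧ G.totalDegree ≤ Fintype.card F - 1 ∧
      (m 0 < Fintype.card F - 1 → ∀ v ∈ G.support, v 0 < Fintype.card F - 1) ∧
      ∀ z, eval z G ≠ 0 → d < degOn f (graphSet z) := by
  classical
  have hle : ∀ m' ∈ P.support, m'.degree ≤ m.degree := fun m' h => by
    rw [hmax]
    exact le_totalDegree h
  have hqpos : 0 < Fintype.card F := Fintype.card_pos
  -- The distribution starts with all of m 0 in part 0, where the multinomial coefficient is 1.
  obtain ⟨w, hw1, hw2, hw3, hw4⟩ := exists_distribution (r := r) hp (fun i : Fin k => m i.succ) (m 0)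
    (Fin.cons (m 0) 0) rfl (by have := hred m hm 0; simp only [Fin.cons_zero]; omega)
    (by
      have := Nat.multinomial_spec Finset.univ (Fin.cons (m 0) 0 : Fin (k + 1) → ℕ)
      rw [Fin.prod_univ_succ, Fin.sum_univ_succ] at this
      simp only [Fin.cons_zero, Fin.cons_succ, Pi.zero_apply, Nat.factorial_zero,
        Finset.prod_const_one, mul_one, Finset.sum_const_zero, add_zero] at this
      have h1 := Nat.eq_of_mul_eq_mul_left (Nat.factorial_pos _) (this.trans (mul_one _).symm)
      rw [h1]
      exact hp.one_lt.ne' ∘ Nat.dvd_one.1)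
    (fun i => by have := hred m hm i.succ; simp only [Fin.cons_succ, Pi.zero_apply]; omega)
  rw [Fin.sum_univ_succ (Fin.cons (m 0) 0 : Fin (k + 1) → ℕ)] at hw1
  simp only [Fin.cons_zero, Fin.cons_succ, Pi.zero_apply, Finset.sum_const_zero, add_zero] at hw1
  set v : Fin (k + 1) →₀ ℕ := Finsupp.equivFunOnFinite.symm w with hv
  have hvw : ∀ i, v i = w i := fun i => rfl
  have hvdeg : v.degree = m 0 := by rw [Finsupp.degree_eq_sum, ← hw1]; rfl
  set e : Fin k →₀ ℕ := m.tail + v.tail with he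
  have hei : ∀ i, e i = m i.succ + w i.succ := fun i => rfl
  have hrede : redMon (Fintype.card F) e = e := by
    ext i
    rw [redMon_apply]
    refine redExp_of_le ?_
    have := hw3 i
    rw [hei]
    omega
  have hdege : e.degree = m.tail.degree + v.tail.degree := map_add _ _ _
  have hde : d < e.degree := by
    rcases hw4 with h0 | h
    · have h1 := degree_eq_add_degree_tail m
      have h2 := degree_eq_add_degree_tail v
      rw [hvw, h0] at h2
      omega
    · refine hd.trans_le ?_
      rw [Finsupp.degree_eq_sum]
      refine le_trans ?_ (Finset.sum_le_sum fun i _ => h i)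
      simp
  refine ⟨coeffPoly (Fintype.card F) P e, ?_, ?_, ?_, fun z hz => lt_degOn_graphSet hP hde hz⟩
  · intro h0
    have h1 := coeff_coeffPoly (Fintype.card F) P e v
    -- Reduction never raises an exponent, so any m' contributing to z^v dominates m entrywise; as m
    -- has top degree, m' = m and nothing cancels.
    have h2 : {m' ∈ P.support | m' 0 = v.degree ∧ redMon (Fintype.card F) (m'.tail + v.tail) = e} =
        {m} := by
      ext m'
      rw [Finset.mem_filter, Finset.mem_singleton]
      constructor
      · rintro ⟨hm', h3, h4⟩
        have h5 : ∀ i, m i ≤ m' i := by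
          refine Fin.cases (by omega) fun i => ?_
          have h6 := DFunLike.congr_fun h4 i
          rw [redMon_apply, hei] at h6
          have h7 := redExp_le_self (Fintype.card F) ((m'.tail + v.tail) i)
          rw [h6] at h7
          have h8 : (m'.tail + v.tail) i = m' i.succ + w i.succ := rfl
          omega
        have h9 := hle m' hm'
        rw [Finsupp.degree_eq_sum, Finsupp.degree_eq_sum] at h9
        ext i
        by_contra hne
        have : ∑ i, m i < ∑ i, m' i := Finset.sum_lt_sum (fun i _ => h5 i)
          ⟨i, Finset.mem_univ i, lt_of_le_of_ne (h5 i) (Ne.symm hne)⟩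
        omega
      · rintro rfl
        exact ⟨hm, hvdeg.symm, hrede⟩
    rw [h0, h2, Finset.sum_singleton, coeff_zero] at h1
    rcases mul_eq_zero.1 h1.symm with h3 | h3
    · exact (mem_support_iff.1 hm) h3
    · have hr : r ≠ 0 := by
        rintro rfl
        have := Fintype.one_lt_card (α := F)
        simp at hF
        omega
      have : CharP F p := by
        have := Fact.mk hp
        exact charP_of_card_eq_prime_pow hF
      exact hw2 ((CharP.cast_eq_zero_iff F p _).1 h3)
  · refine Finset.sup_le fun u hu => ?_
    obtain ⟨m', hm', h1, -⟩ := exists_of_mem_support_coeffPoly hu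
    exact h1.symm.le.trans (hred m' hm' 0)
  -- If u 0 ≥ q - 1, then u has no other entries, so e is the reduction of m'.tail. Since m 0 < q -
  -- 1 ≤ m' 0 and m has top degree, m'.tail has smaller degree than m.tail, hence than e: a
  -- contradiction.
  · intro hm0 u hu
    obtain ⟨m', hm', h1, h2⟩ := exists_of_mem_support_coeffPoly hu
    by_contra! h3
    have h4 := hred m' hm' 0
    have h5 := degree_eq_add_degree_tail u
    have h6 : u.tail = 0 := by
      rw [← Finsupp.degree_eq_zero_iff]
      omega
    rw [h6, add_zero] at h2
    have h7 := degree_redMon_le (Fintype.card F) m'.tail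
    rw [h2] at h7
    have h8 := hle m' hm'
    have h9 := degree_eq_add_degree_tail m'
    have h10 := degree_eq_add_degree_tail m
    omega

/-! ### Nonzeros of the witness polynomial -/

/-- The power sums ∑ b^j over F vanish for j < q - 1. -/
theorem sum_eval_cons_eq_zero [Fintype F] {k : ℕ} {G : MvPolynomial (Fin (k + 1)) F}
    (hG : ∀ v ∈ G.support, v 0 < Fintype.card F - 1) (a : Fin k → F) :
    ∑ b : F, eval (Fin.cons b a) G = 0 := by
  simp only [eval_eq']
  rw [Finset.sum_comm]
  refine Finset.sum_eq_zero fun v hv => ?_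
  simp only [Fin.prod_univ_succ, Fin.cons_zero, Fin.cons_succ]
  rw [← Finset.mul_sum, ← Finset.sum_mul, FiniteField.sum_pow_lt_card_sub_one _ _ (hG v hv)]
  simp

/-- A vanishing sum cannot have exactly one nonzero term. -/
theorem exists_two_ne_zero [Fintype F] {k : ℕ} {G : MvPolynomial (Fin (k + 1)) F}
    (hG : ∀ v ∈ G.support, v 0 < Fintype.card F - 1) {a : Fin k → F} {b : F}
    (hb : eval (Fin.cons b a) G ≠ 0) : ∃ b' ≠ b, eval (Fin.cons b' a) G ≠ 0 := by
  by_contra! h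
  refine hb ?_
  rw [← sum_eval_cons_eq_zero hG a, Finset.sum_eq_single b (fun b' _ hb' => h b' hb') (by simp)]

/-- A nonzero polynomial of degree at most `q - 1` is nonzero on at least a `1 / q` fraction of the
points. -/
theorem card_ne_zero_ge [Fintype F] [DecidableEq F] {k : ℕ} {G : MvPolynomial (Fin (k + 1)) F}
    (h0 : G ≠ 0) (hG : G.totalDegree ≤ Fintype.card F - 1) :
    Fintype.card F ^ k ≤ Finset.card {z : Fin (k + 1) → F | eval z G ≠ 0} := by
  have h := schwartz_zippel_totalDegree h0 (Finset.univ : Finset F)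
  rw [Finset.card_univ, Fintype.piFinset_univ] at h
  have hq : 0 < Fintype.card F := Fintype.card_pos
  have hsum := Finset.card_filter_add_card_filter_not (s := (Finset.univ : Finset (Fin (k + 1) → F)))
    (fun z => eval z G = 0)
  rw [Finset.card_univ, Fintype.card_fun, Fintype.card_fin] at hsum
  set Z := Finset.card {z : Fin (k + 1) → F | eval z G = 0}
  rw [div_le_div_iff₀ (by positivity) (by positivity)] at h
  have h' : Z * Fintype.card F ≤ G.totalDegree * Fintype.card F ^ (k + 1) := by exact_mod_cast h
  have h2 : Z ≤ (Fintype.card F - 1) * Fintype.card F ^ k := by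
    refine Nat.le_of_mul_le_mul_right (h'.trans ?_) hq
    rw [mul_assoc, ← pow_succ]
    exact Nat.mul_le_mul_right _ hG
  have h3 : Fintype.card F ^ (k + 1) = (Fintype.card F - 1) * Fintype.card F ^ k +
      Fintype.card F ^ k := by
    obtain ⟨c, hc⟩ : ∃ c, Fintype.card F = c + 1 := ⟨_, (Nat.succ_pred_eq_of_pos hq).symm⟩
    rw [hc, Nat.add_sub_cancel]
    ring
  simp only [ne_eq]
  omega

/-! ### Hyperplanes and their equations -/

/-- The hyperplane `l x = b`. -/
def hyperplane {n : ℕ} (l : Module.Dual F (Fin n → F)) (b : F) : AffineSubspace F (Fin n → F) where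
  carrier := {x | l x = b}
  smul_vsub_vadd_mem' := by
    intro c x y z hx hy hz
    simp only [Set.mem_ofPred_eq] at *
    simp [hx, hy, hz]

theorem mem_hyperplane {n : ℕ} {l : Module.Dual F (Fin n → F)} {b : F} {x : Fin n → F} :
    x ∈ hyperplane l b ↔ l x = b := Iff.rfl

theorem coe_hyperplane {n : ℕ} (l : Module.Dual F (Fin n → F)) (b : F) :
    (hyperplane l b : Set (Fin n → F)) = {x | l x = b} := rfl

theorem hyperplane_smul {n : ℕ} (c : Fˣ) (l : Module.Dual F (Fin n → F)) (b : F) :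
    hyperplane ((c : F) • l) (c * b) = hyperplane l b := by
  ext x
  rw [mem_hyperplane, mem_hyperplane, LinearMap.smul_apply, smul_eq_mul]
  exact mul_right_inj' c.ne_zero

theorem hyperplane_nonempty {n : ℕ} {l : Module.Dual F (Fin n → F)} (hl : l ≠ 0) (b : F) :
    ∃ x, x ∈ hyperplane l b := LinearMap.surjective hl b

theorem direction_hyperplane {n : ℕ} {l : Module.Dual F (Fin n → F)} (hl : l ≠ 0) (b : F) :
    (hyperplane l b).direction = LinearMap.ker l := by
  obtain ⟨x, hx⟩ := hyperplane_nonempty hl b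
  ext v
  rw [AffineSubspace.mem_direction_iff_eq_vsub_right hx, LinearMap.mem_ker]
  rw [mem_hyperplane] at hx
  constructor
  · rintro ⟨y, hy, rfl⟩
    rw [mem_hyperplane] at hy
    simp [hx, hy]
  · intro hv
    exact ⟨v + x, by rw [mem_hyperplane, map_add, hv, hx, zero_add], by simp⟩

theorem hyperplane_mem_flats {k : ℕ} {l : Module.Dual F (Fin (k + 1) → F)} (hl : l ≠ 0) (b : F) :
    hyperplane l b ∈ flats F (k + 1) k := by
  refine ⟨hyperplane_nonempty hl b, ?_⟩
  rw [direction_hyperplane hl]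
  have := Module.Dual.finrank_ker_add_one_of_ne_zero hl
  rw [Module.finrank_fin_fun] at this
  omega

theorem exists_eq_hyperplane {k : ℕ} {A : AffineSubspace F (Fin (k + 1) → F)}
    (hA : A ∈ flats F (k + 1) k) : ∃ l ≠ 0, ∃ b, A = hyperplane l b := by
  obtain ⟨⟨x, hx⟩, hr⟩ := hA
  have hlt : A.direction < ⊤ := by
    rw [lt_top_iff_ne_top]
    intro h
    rw [h, finrank_top, Module.finrank_fin_fun] at hr
    omega
  obtain ⟨l, hl, hle⟩ := Submodule.exists_le_ker_of_lt_top _ hlt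
  have hker := Module.Dual.finrank_ker_add_one_of_ne_zero hl
  rw [Module.finrank_fin_fun] at hker
  refine ⟨l, hl, l x, AffineSubspace.ext_of_direction_eq ?_ ⟨x, hx, rfl⟩⟩
  rw [direction_hyperplane hl]
  exact Submodule.eq_of_le_of_finrank_eq hle (by omega)

/-- Equal hyperplanes have equal directions, so the forms have the same kernel and are proportional;
a common point then fixes the constant. -/
theorem exists_unit_of_hyperplane_eq {n : ℕ} {l l' : Module.Dual F (Fin n → F)} {b b' : F}
    (hl : l ≠ 0) (hl' : l' ≠ 0) (h : hyperplane l' b' = hyperplane l b) :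
    ∃ c : Fˣ, (c : F) • l = l' ∧ c * b = b' := by
  have hk : LinearMap.ker l' = LinearMap.ker l := by
    rw [← direction_hyperplane hl' b', ← direction_hyperplane hl b, h]
  have hmem : l' ∈ Submodule.span F (Set.range fun _ : Unit => l) :=
    mem_span_of_iInf_ker_le_ker (by simp [hk])
  rw [Set.range_const, Submodule.mem_span_singleton] at hmem
  obtain ⟨c, hc⟩ := hmem
  have hc0 : c ≠ 0 := by
    rintro rfl
    exact hl' (by rw [← hc, zero_smul])
  obtain ⟨x, hx⟩ := hyperplane_nonempty hl b
  have hx' : x ∈ hyperplane l' b' := h ▸ hx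
  refine ⟨Units.mk0 c hc0, hc, ?_⟩
  rw [mem_hyperplane] at hx hx'
  rw [← hx', ← hc, ← hx]
  rfl

noncomputable instance fintypeDual [Fintype F] {n : ℕ} : Fintype (Module.Dual F (Fin n → F)) :=
  @Fintype.ofFinite _ (Module.finite_of_finite F)

theorem card_dual [Fintype F] (n : ℕ) :
    Fintype.card (Module.Dual F (Fin n → F)) = Fintype.card F ^ n := by
  rw [Module.card_eq_pow_finrank (K := F), Subspace.dual_finrank_eq, Module.finrank_fin_fun]

open Classical in
/-- Every hyperplane has exactly `q - 1` equations. -/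
theorem card_pairs_eq [Fintype F] {k : ℕ} (S : AffineSubspace F (Fin (k + 1) → F) → Prop) :
    Finset.card {x : Module.Dual F (Fin (k + 1) → F) × F | x.1 ≠ 0 ∧ S (hyperplane x.1 x.2)} =
      {A ∈ flats F (k + 1) k | S A}.ncard * (Fintype.card F - 1) := by
  have : Finite (AffineSubspace F (Fin (k + 1) → F)) :=
    Finite.of_injective _ (SetLike.coe_injective (A := AffineSubspace F (Fin (k + 1) → F)))
  have hfin : {A ∈ flats F (k + 1) k | S A}.Finite := Set.toFinite _
  rw [Set.ncard_eq_toFinset_card _ hfin,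
    Finset.card_eq_sum_card_fiberwise (f := fun x => hyperplane x.1 x.2) (t := hfin.toFinset),
    Finset.sum_const_nat (m := Fintype.card F - 1)]
  · intro A hA
    obtain ⟨hA, hS⟩ := (Set.Finite.mem_toFinset hfin).1 hA
    obtain ⟨l, hl, b, rfl⟩ := exists_eq_hyperplane hA
    rw [← Fintype.card_units, ← Finset.card_univ]
    symm
    refine Finset.card_bij (fun c _ => ((c : F) • l, c * b)) ?_ ?_ ?_
    · intro c _
      simp only [Finset.mem_filter, Finset.mem_univ, true_and]
      rw [hyperplane_smul]
      exact ⟨⟨smul_ne_zero c.ne_zero hl, hS⟩, rfl⟩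
    · intro c _ c' _ h
      exact Units.ext (smul_left_injective F hl (Prod.ext_iff.1 h).1)
    · rintro ⟨l', b'⟩ hx
      simp only [Finset.mem_filter, Finset.mem_univ, true_and] at hx
      obtain ⟨c, h1, h2⟩ := exists_unit_of_hyperplane_eq hl hx.1.1 hx.2
      exact ⟨c, Finset.mem_univ c, Prod.ext h1 h2⟩
  · intro x hx
    have hx := (Finset.mem_filter.1 (Finset.mem_coe.1 hx)).2
    exact Finset.mem_coe.2 ((Set.Finite.mem_toFinset hfin).2 ⟨hyperplane_mem_flats hx.1 _, hx.2⟩)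

/-! ### Linear changes of coordinates and graph forms -/

theorem degOn_comp_linearEquiv_le [Finite F] {n : ℕ} (f : (Fin n → F) → F)
    (T : (Fin n → F) ≃ₗ[F] (Fin n → F)) (S : Set (Fin n → F)) :
    degOn (f ∘ T) (T ⁻¹' S) ≤ degOn f S := by
  obtain ⟨P, hP, hPf⟩ := (degOn_le_iff f S _).1 le_rfl
  obtain ⟨Q, hQ, hQe⟩ := exists_comp_affine T.toLinearMap.toAffineMap P
  exact (degOn_le_iff _ _ _).2 ⟨Q, hQ.trans hP, fun x hx => (hQe x).trans (hPf _ hx)⟩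

theorem degOn_comp_linearEquiv [Finite F] {n : ℕ} (f : (Fin n → F) → F)
    (T : (Fin n → F) ≃ₗ[F] (Fin n → F)) (S : Set (Fin n → F)) :
    degOn (f ∘ T) (T ⁻¹' S) = degOn f S := by
  refine le_antisymm (degOn_comp_linearEquiv_le f T S) ?_
  have h := degOn_comp_linearEquiv_le (f ∘ T) T.symm (T ⁻¹' S)
  have h1 : (f ∘ T) ∘ T.symm = f := by ext; simp
  have h2 : T.symm ⁻¹' (T ⁻¹' S) = S := by ext; simp
  rwa [h1, h2] at h

theorem deg_comp_linearEquiv [Finite F] {n : ℕ} (f : (Fin n → F) → F)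
    (T : (Fin n → F) ≃ₗ[F] (Fin n → F)) : deg (f ∘ T) = deg f :=
  degOn_comp_linearEquiv f T Set.univ

theorem degOn_hyperplane_comp [Finite F] {n : ℕ} (f : (Fin n → F) → F)
    (T : (Fin n → F) ≃ₗ[F] (Fin n → F)) (l : Module.Dual F (Fin n → F)) (b : F) :
    degOn (f ∘ T) (hyperplane (l ∘ₗ T.toLinearMap) b : Set (Fin n → F)) =
      degOn f (hyperplane l b : Set (Fin n → F)) :=
  degOn_comp_linearEquiv f T (hyperplane l b : Set (Fin n → F))

/-- The linear form `x 0 - ∑ i, a i * x (i + 1)`. -/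
noncomputable def graphForm {k : ℕ} (a : Fin k → F) : Module.Dual F (Fin (k + 1) → F) :=
  LinearMap.proj 0 - ∑ i, a i • LinearMap.proj i.succ

theorem graphForm_apply {k : ℕ} (a : Fin k → F) (x : Fin (k + 1) → F) :
    graphForm a x = x 0 - ∑ i, a i * x i.succ := by
  simp [graphForm]

theorem graphForm_single_zero {k : ℕ} (a : Fin k → F) :
    graphForm a (Pi.single 0 1) = 1 := by
  simp [graphForm_apply]

theorem graphForm_single_succ {k : ℕ} (a : Fin k → F) (i : Fin k) :
    graphForm a (Pi.single i.succ 1) = - a i := by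
  simp [graphForm_apply, Pi.single_apply]

theorem graphForm_ne_zero {k : ℕ} (a : Fin k → F) : graphForm a ≠ 0 := by
  intro h
  have := graphForm_single_zero a
  rw [h] at this
  simp at this

theorem hyperplane_graphForm {k : ℕ} (z : Fin (k + 1) → F) :
    (hyperplane (graphForm (Fin.tail z)) (z 0) : Set (Fin (k + 1) → F)) = graphSet z := by
  ext x
  rw [coe_hyperplane, Set.mem_ofPred_eq, graphForm_apply, sub_eq_iff_eq_add]
  rfl

/-! ### Existence of two parallel bad hyperplanes -/

theorem exists_mem_support_degree_eq {n : ℕ} {P : MvPolynomial (Fin n) F}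
    (hP : 0 < P.totalDegree) : ∃ m ∈ P.support, m.degree = P.totalDegree := by
  have hne : P.support.Nonempty := by
    rw [Finset.nonempty_iff_ne_empty]
    intro h
    rw [MvPolynomial.support_eq_empty] at h
    simp [h] at hP
  obtain ⟨m, hm, h⟩ := Finset.exists_mem_eq_sup _ hne fun s : Fin n →₀ ℕ => s.sum fun _ e => e
  exact ⟨m, hm, h.symm⟩

theorem exists_two_of_exponent_lt [Fintype F] {p r k d : ℕ} (hp : p.Prime)
    (hF : Fintype.card F = p ^ r) (hd : d < k * (p ^ r - p ^ (r - 1)))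
    {f : (Fin (k + 1) → F) → F} {P : MvPolynomial (Fin (k + 1)) F} (hP : ∀ x, eval x P = f x)
    (hred : ∀ m ∈ P.support, ∀ i, m i ≤ Fintype.card F - 1)
    {m : Fin (k + 1) →₀ ℕ} (hm : m ∈ P.support) (hmax : m.degree = P.totalDegree)
    (hdm : d < m.degree) (hm0 : m 0 < Fintype.card F - 1) :
    ∃ l : Module.Dual F (Fin (k + 1) → F), l ≠ 0 ∧ ∃ b b', b' ≠ b ∧
      d < degOn f (hyperplane l b : Set _) ∧ d < degOn f (hyperplane l b' : Set _) := by
  classical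
  obtain ⟨G, hG0, hG1, hG2, hG3⟩ := exists_witness hp hF hd hP hred hm hmax hdm
  have hpos := (Nat.pow_pos (n := k) (Fintype.card_pos (α := F))).trans_le (card_ne_zero_ge hG0 hG1)
  obtain ⟨z, hz⟩ := Finset.card_pos.1 hpos
  have hz := (Finset.mem_filter.1 hz).2
  rw [← Fin.cons_self_tail z] at hz
  obtain ⟨b', hb', hz'⟩ := exists_two_ne_zero (hG2 hm0) hz
  have h1 := hG3 _ hz
  have h2 := hG3 _ hz'
  rw [← hyperplane_graphForm] at h1 h2
  exact ⟨graphForm (Fin.tail z), graphForm_ne_zero _, z 0, b', hb', h1, h2⟩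

/-- Below the maximal degree, some parallel class contains two hyperplanes of large degree. -/
theorem exists_two [Fintype F] {p r k d : ℕ} (hp : p.Prime)
    (hF : Fintype.card F = p ^ r) (hd : d < k * (p ^ r - p ^ (r - 1)))
    {f : (Fin (k + 1) → F) → F} (hf : d < deg f)
    (hf' : deg f < (k + 1) * (Fintype.card F - 1)) :
    ∃ l : Module.Dual F (Fin (k + 1) → F), l ≠ 0 ∧ ∃ b b', b' ≠ b ∧
      d < degOn f (hyperplane l b : Set _) ∧ d < degOn f (hyperplane l b' : Set _) := by
  obtain ⟨P, hP, hPd, hred⟩ := exists_reduced_poly f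
  obtain ⟨m, hm, hmax⟩ := exists_mem_support_degree_eq (P := P) (by omega)
  obtain ⟨i, hi⟩ : ∃ i, m i < Fintype.card F - 1 := by
    by_contra! h
    have h1 : ∑ _i : Fin (k + 1), (Fintype.card F - 1) ≤ m.degree := by
      rw [Finsupp.degree_eq_sum]
      exact Finset.sum_le_sum fun i _ => h i
    rw [Finset.sum_const, Finset.card_univ, Fintype.card_fin, smul_eq_mul] at h1
    omega
  -- The variable with exponent below q - 1 becomes the one solved for in the graph equation.
  let σ : Equiv.Perm (Fin (k + 1)) := Equiv.swap 0 i
  let T : (Fin (k + 1) → F) ≃ₗ[F] (Fin (k + 1) → F) := LinearEquiv.funCongrLeft F F σ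
  have hT : ∀ x, T x = x ∘ σ := fun x => rfl
  have hdeg : ∀ s : Fin (k + 1) →₀ ℕ, (s.mapDomain σ).degree = s.degree := fun s => by
    rw [Finsupp.degree_eq_sum, Finsupp.degree_eq_sum, ← Equiv.sum_comp σ]
    exact Finset.sum_congr rfl fun j _ => Finsupp.mapDomain_apply σ.injective _ _
  have hsupp : (rename σ P).support = P.support.map (Finsupp.mapDomainEmbedding σ.toEmbedding) := by
    classical
    rw [support_rename_of_injective σ.injective, Finset.map_eq_image]
    rfl
  obtain ⟨l, hl, b, b', hb, h1, h2⟩ := exists_two_of_exponent_lt (f := f ∘ T) (P := rename σ P)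
    (m := m.mapDomain σ) hp hF hd
    (fun x => by rw [eval_rename, hP]; rfl)
    (by
      intro s hs j
      rw [hsupp, Finset.mem_map] at hs
      obtain ⟨s, hs, rfl⟩ := hs
      have := hred s hs (σ.symm j)
      rw [← Finsupp.mapDomain_apply σ.injective, Equiv.apply_symm_apply] at this
      exact this)
    (by
      rw [hsupp]
      exact Finset.mem_map_of_mem _ hm)
    (by
      rw [hdeg, hmax, ← totalDegree_renameEquiv σ P]
      rfl)
    (by rw [hdeg]; omega)
    (by
      have : m.mapDomain σ (σ i) = m i := Finsupp.mapDomain_apply σ.injective _ _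
      rw [show σ i = 0 from Equiv.swap_apply_right 0 i] at this
      omega)
  have hl' : l = (l ∘ₗ T.symm.toLinearMap) ∘ₗ T.toLinearMap := by
    ext
    simp
  rw [hl', degOn_hyperplane_comp] at h1 h2
  refine ⟨l ∘ₗ T.symm.toLinearMap, fun h => hl ?_, b, b', hb, h1, h2⟩
  rw [hl', h, LinearMap.zero_comp]

/-! ### Bad hyperplanes transversal to a direction -/

open Classical in
-- Each nonzero z of the witness gives a bad graph, and each graph has q - 1 equations. The scalar
-- is read off from the value at the first basis vector, so no equation is counted twice.
theorem card_transversal_single_ge [Fintype F] {p r k d : ℕ} (hp : p.Prime)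
    (hF : Fintype.card F = p ^ r) (hd : d < k * (p ^ r - p ^ (r - 1)))
    {f : (Fin (k + 1) → F) → F} (hf : d < deg f) :
    (Fintype.card F - 1) * Fintype.card F ^ k ≤
      Finset.card {x : Module.Dual F (Fin (k + 1) → F) × F |
        x.1 (Pi.single 0 1) ≠ 0 ∧ d < degOn f (hyperplane x.1 x.2 : Set (Fin (k + 1) → F))} := by
  obtain ⟨P, hP, hPd, hred⟩ := exists_reduced_poly f
  obtain ⟨m, hm, hmax⟩ := exists_mem_support_degree_eq (P := P) (by omega)
  obtain ⟨G, hG0, hG1, -, hG3⟩ := exists_witness hp hF hd hP hred hm hmax (by omega)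
  refine (Nat.mul_le_mul_left _ (card_ne_zero_ge hG0 hG1)).trans ?_
  rw [← Fintype.card_units, ← Finset.card_univ, ← Finset.card_product]
  refine Finset.card_le_card_of_injOn
    (fun y => ((y.1 : F) • graphForm (Fin.tail y.2), y.1 * y.2 0)) ?_ ?_
  · rintro ⟨c, z⟩ hz
    have hz := (Finset.mem_filter.1 (Finset.mem_product.1 (Finset.mem_coe.1 hz)).2).2
    refine Finset.mem_coe.2 (Finset.mem_filter.2 ⟨Finset.mem_univ _, ?_, ?_⟩)
    · simp [graphForm_single_zero]
    · dsimp only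
      rw [hyperplane_smul, hyperplane_graphForm]
      exact hG3 z hz
  · rintro ⟨c, z⟩ - ⟨c', z'⟩ - h
    obtain ⟨h1, h2⟩ := Prod.ext_iff.1 h
    dsimp only at h1 h2
    have hc : c = c' := by
      have := LinearMap.congr_fun h1 (Pi.single 0 1)
      simp only [LinearMap.smul_apply, graphForm_single_zero, smul_eq_mul, mul_one] at this
      exact Units.ext this
    subst hc
    refine Prod.ext rfl (funext (Fin.cases (mul_left_cancel₀ c.ne_zero h2) fun i => ?_))
    have := LinearMap.congr_fun h1 (Pi.single i.succ 1)
    simp only [LinearMap.smul_apply, graphForm_single_succ, smul_eq_mul] at this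
    exact neg_injective (mul_left_cancel₀ c.ne_zero this)

/-- The isomorphism between the lines spanned by u and v extends to the whole space. -/
theorem exists_linearEquiv_apply_eq {V : Type*} [AddCommGroup V] [Module F V]
    [FiniteDimensional F V] {u v : V} (hu : u ≠ 0) (hv : v ≠ 0) : ∃ T : V ≃ₗ[F] V, T u = v := by
  obtain ⟨T, hT⟩ := Submodule.exists_linearEquiv_restrict_eq
    ((LinearEquiv.toSpanNonzeroSingleton F V u hu).symm ≪≫ₗ
      LinearEquiv.toSpanNonzeroSingleton F V v hv)
  refine ⟨T, ?_⟩
  have h := hT (LinearEquiv.toSpanNonzeroSingleton F V u hu 1)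
  rw [LinearEquiv.trans_apply, LinearEquiv.symm_apply_apply] at h
  simpa using h.symm

open Classical in
/-- Among the hyperplanes transversal to a given direction, at least a `1 / q` fraction have large
degree. -/
theorem card_transversal_ge [Fintype F] {p r k d : ℕ} (hp : p.Prime)
    (hF : Fintype.card F = p ^ r) (hd : d < k * (p ^ r - p ^ (r - 1)))
    {f : (Fin (k + 1) → F) → F} (hf : d < deg f) {v : Fin (k + 1) → F} (hv : v ≠ 0) :
    (Fintype.card F - 1) * Fintype.card F ^ k ≤
      Finset.card {x : Module.Dual F (Fin (k + 1) → F) × F |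
        x.1 v ≠ 0 ∧ d < degOn f (hyperplane x.1 x.2 : Set (Fin (k + 1) → F))} := by
  obtain ⟨T, hT⟩ := exists_linearEquiv_apply_eq (F := F) (u := Pi.single (0 : Fin (k + 1)) (1 : F))
    (by simp) hv
  refine (card_transversal_single_ge hp hF hd (f := f ∘ T)
    (by rwa [deg_comp_linearEquiv])).trans ?_
  refine Finset.card_le_card_of_injOn (fun x => (x.1 ∘ₗ T.symm.toLinearMap, x.2)) ?_ ?_
  · rintro ⟨l, b⟩ hx
    obtain ⟨-, h1, h2⟩ := Finset.mem_filter.1 (Finset.mem_coe.1 hx)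
    refine Finset.mem_coe.2 (Finset.mem_filter.2 ⟨Finset.mem_univ _, ?_, ?_⟩)
    · simpa [← hT] using h1
    · rw [← degOn_hyperplane_comp f T]
      convert h2 using 5
      ext
      simp
  · rintro ⟨l, b⟩ - ⟨l', b'⟩ - h
    obtain ⟨h1, h2⟩ := Prod.ext_iff.1 h
    refine Prod.ext (LinearMap.ext fun x => ?_) h2
    simpa using LinearMap.congr_fun h1 (T x)

/-! ### Double counting over directions in a hyperplane -/

open Classical in
theorem card_ker_eq [Fintype F] {k : ℕ} {l : Module.Dual F (Fin (k + 1) → F)} (hl : l ≠ 0) :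
    Finset.card {v : Fin (k + 1) → F | l v = 0} = Fintype.card F ^ k := by
  have h := Module.card_eq_pow_finrank (K := F) (V := LinearMap.ker l)
  have hker := Module.Dual.finrank_ker_add_one_of_ne_zero hl
  rw [Module.finrank_fin_fun] at hker
  rw [show Module.finrank F (LinearMap.ker l) = k by omega] at h
  rw [← h, Fintype.card_subtype]
  rfl

open Classical in
theorem card_ker_inter_ge [Fintype F] {k : ℕ} (l l' : Module.Dual F (Fin (k + 1) → F)) :
    Fintype.card F ^ (k - 1) ≤ Finset.card {v : Fin (k + 1) → F | l v = 0 ∧ l' v = 0} := by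
  have h := Module.card_eq_pow_finrank (K := F) (V := LinearMap.ker (l.prod l'))
  have hrn := LinearMap.finrank_range_add_finrank_ker (l.prod l')
  have hle := Submodule.finrank_le (LinearMap.range (l.prod l'))
  rw [Module.finrank_prod, Module.finrank_self] at hle
  rw [Module.finrank_fin_fun] at hrn
  refine (Nat.pow_le_pow_right Fintype.card_pos
    (show k - 1 ≤ Module.finrank F (LinearMap.ker (l.prod l')) by omega)).trans ?_
  rw [← h, Fintype.card_subtype]
  refine Finset.card_le_card fun v hv => ?_
  simpa using hv

/-- Cancelling q^k - q^(k-1) = (q - 1)q^(k-1) leaves (q^k - 1)q ≤ N. -/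
theorem pow_succ_le_of_mul_le {q k N : ℕ} (hq : 1 < q) (hk : k ≠ 0)
    (h : (q ^ k - 1) * ((q - 1) * q ^ k) ≤ N * (q ^ k - q ^ (k - 1))) : q ^ (k + 1) ≤ N + q := by
  obtain ⟨j, rfl⟩ := Nat.exists_eq_succ_of_ne_zero hk
  obtain ⟨c, rfl⟩ : ∃ c, q = c + 1 := ⟨q - 1, by omega⟩
  have h1 : (c + 1) ^ (j + 1) - (c + 1) ^ j = c * (c + 1) ^ j := by
    rw [pow_succ, mul_add, mul_one, Nat.add_sub_cancel, mul_comm]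
  rw [Nat.succ_eq_add_one, Nat.add_sub_cancel, Nat.add_sub_cancel, h1] at h
  have h2 : ((c + 1) ^ (j + 1) - 1) * (c + 1) ≤ N := by
    have hpos : 0 < c * (c + 1) ^ j := Nat.mul_pos (by omega) (Nat.pow_pos (by omega))
    refine Nat.le_of_mul_le_mul_right (le_trans (le_of_eq ?_) h) hpos
    ring
  rw [Nat.sub_mul, one_mul, ← pow_succ] at h2
  rw [Nat.succ_eq_add_one]
  omega

open Classical in
/-- The double count over the directions contained in a given hyperplane. -/
theorem card_bad_ge [Fintype F] {p r k d : ℕ} (hp : p.Prime)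
    (hF : Fintype.card F = p ^ r) (hd : d < k * (p ^ r - p ^ (r - 1)))
    {f : (Fin (k + 1) → F) → F} (hf : d < deg f) {l : Module.Dual F (Fin (k + 1) → F)}
    (hl : l ≠ 0) :
    Fintype.card F ^ (k + 1) + (Fintype.card F - 1) *
        Finset.card {b : F | d < degOn f (hyperplane l b : Set (Fin (k + 1) → F))} ≤
      Finset.card {x : Module.Dual F (Fin (k + 1) → F) × F | x.1 ≠ 0 ∧
        d < degOn f (hyperplane x.1 x.2 : Set (Fin (k + 1) → F))} + Fintype.card F := by
  have hk : k ≠ 0 := by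
    rintro rfl
    simp at hd
  have hq : 1 < Fintype.card F := Fintype.one_lt_card
  set q := Fintype.card F with hqdef
  set B : Finset (Module.Dual F (Fin (k + 1) → F) × F) := {x | x.1 ≠ 0 ∧
        d < degOn f (hyperplane x.1 x.2 : Set (Fin (k + 1) → F))} with hB
  set B₀ := {x ∈ B | x.1 ∈ Submodule.span F {l}} with hB₀
  set B₁ := {x ∈ B | x.1 ∉ Submodule.span F {l}} with hB₁
  have hsplit : B₀.card + B₁.card = B.card :=
    Finset.card_filter_add_card_filter_not (s := B) (fun x => x.1 ∈ Submodule.span F {l})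
  have hB₀card : (q - 1) * Finset.card {b : F | d < degOn f (hyperplane l b : Set _)} ≤
      B₀.card := by
    rw [hqdef, ← Fintype.card_units, ← Finset.card_univ, ← Finset.card_product]
    refine Finset.card_le_card_of_injOn (fun y => ((y.1 : F) • l, y.1 * y.2)) ?_ ?_
    · rintro ⟨c, b⟩ hb
      have hb := (Finset.mem_filter.1 (Finset.mem_product.1 (Finset.mem_coe.1 hb)).2).2
      refine Finset.mem_coe.2 (Finset.mem_filter.2 ⟨Finset.mem_filter.2 ⟨Finset.mem_univ _,
        smul_ne_zero c.ne_zero hl, ?_⟩, Submodule.smul_mem _ _ (Submodule.mem_span_singleton_self l)⟩)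
      dsimp only
      rw [hyperplane_smul]
      exact hb
    · rintro ⟨c, b⟩ - ⟨c', b'⟩ - h
      obtain ⟨h1, h2⟩ := Prod.ext_iff.1 h
      have hc : c = c' := Units.ext (smul_left_injective F hl h1)
      subst hc
      exact Prod.ext rfl (mul_left_cancel₀ c.ne_zero h2)
  -- With directions taken in ker l, multiples of l are transversal to none of them, so only B₁
  -- contributes to the count and B₀ is extra.
  set S : Finset (Fin (k + 1) → F) := {v | l v = 0} with hS
  have hScard : S.card = q ^ k := card_ker_eq hl
  have hS0 : (0 : Fin (k + 1) → F) ∈ S := by simp [hS]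
  have hdc := Finset.sum_card_bipartiteAbove_eq_sum_card_bipartiteBelow
    (fun (v : Fin (k + 1) → F) (x : Module.Dual F (Fin (k + 1) → F) × F) => x.1 v ≠ 0)
    (s := S.erase 0) (t := B)
  have hlow : (q ^ k - 1) * ((q - 1) * q ^ k) ≤ ∑ v ∈ S.erase 0, (Finset.bipartiteAbove
      (fun (v : Fin (k + 1) → F) (x : Module.Dual F (Fin (k + 1) → F) × F) => x.1 v ≠ 0)
      B v).card := by
    rw [← hScard, ← Finset.card_erase_of_mem hS0, ← smul_eq_mul, hScard]
    refine Finset.card_nsmul_le_sum _ _ _ fun v hv => ?_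
    refine (card_transversal_ge hp hF hd hf (Finset.ne_of_mem_erase hv)).trans
      (Finset.card_le_card fun x hx => ?_)
    obtain ⟨-, h1, h2⟩ := Finset.mem_filter.1 hx
    refine Finset.mem_filter.2 ⟨Finset.mem_filter.2 ⟨Finset.mem_univ _, ?_, h2⟩, h1⟩
    intro h
    simp [h] at h1
  have hup : ∑ x ∈ B, (Finset.bipartiteBelow
      (fun (v : Fin (k + 1) → F) (x : Module.Dual F (Fin (k + 1) → F) × F) => x.1 v ≠ 0)
      (S.erase 0) x).card ≤ B₁.card * (q ^ k - q ^ (k - 1)) := by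
    rw [← Finset.sum_filter_add_sum_filter_not B (fun x => x.1 ∈ Submodule.span F {l}),
      Finset.sum_eq_zero, zero_add, ← smul_eq_mul]
    · refine Finset.sum_le_card_nsmul _ _ _ fun x _ => ?_
      have h1 := Finset.card_filter_add_card_filter_not (s := S) (fun v => x.1 v = 0)
      have h2 : q ^ (k - 1) ≤ Finset.card {v ∈ S | x.1 v = 0} := by
        rw [hS, Finset.filter_filter]
        exact card_ker_inter_ge l x.1
      have h3 : (Finset.bipartiteBelow
          (fun (v : Fin (k + 1) → F) (x : Module.Dual F (Fin (k + 1) → F) × F) => x.1 v ≠ 0)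
          (S.erase 0) x).card ≤ Finset.card {v ∈ S | ¬ x.1 v = 0} :=
        Finset.card_le_card (Finset.filter_subset_filter _ (Finset.erase_subset _ _))
      omega
    · intro x hx
      obtain ⟨c, hc⟩ := Submodule.mem_span_singleton.1 (Finset.mem_filter.1 hx).2
      rw [Finset.card_eq_zero, Finset.bipartiteBelow, Finset.filter_eq_empty_iff]
      intro v hv
      have hv : l v = 0 := (Finset.mem_filter.1 (Finset.mem_of_mem_erase hv)).2
      rw [← hc, LinearMap.smul_apply, hv, smul_zero]
      simp
  have hmain := hlow.trans (hdc.le.trans hup)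
  have := pow_succ_le_of_mul_le hq hk hmain
  omega

/-! ### Passage to the rejection probability -/

open Classical in
-- Numerator and denominator are both multiplied by q - 1, replacing hyperplanes by their equations.
theorem rejProb_eq [Fintype F] {k d : ℕ} (f : (Fin (k + 1) → F) → F) :
    rejProb k d f = (Finset.card {x : Module.Dual F (Fin (k + 1) → F) × F | x.1 ≠ 0 ∧
        d < degOn f (hyperplane x.1 x.2 : Set (Fin (k + 1) → F))} : ℝ) /
      (((Fintype.card F : ℝ) ^ (k + 1) - 1) * Fintype.card F) := by
  have hq : 1 < Fintype.card F := Fintype.one_lt_card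
  have h1 := card_pairs_eq (F := F) (k := k) fun A => d < degOn f (A : Set (Fin (k + 1) → F))
  have h2 := card_pairs_eq (F := F) (k := k) fun _ => True
  have h3 : Finset.card {x : Module.Dual F (Fin (k + 1) → F) × F | x.1 ≠ 0 ∧ True} =
      (Fintype.card F ^ (k + 1) - 1) * Fintype.card F := by
    have : ({x | x.1 ≠ 0 ∧ True} : Finset (Module.Dual F (Fin (k + 1) → F) × F)) =
        Finset.univ.erase 0 ×ˢ Finset.univ := by
      ext x
      simp
    rw [this, Finset.card_product, Finset.card_erase_of_mem (Finset.mem_univ _), Finset.card_univ,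
      Finset.card_univ, card_dual]
  replace h2 : (Fintype.card F ^ (k + 1) - 1) * Fintype.card F =
      (flats F (k + 1) k).ncard * (Fintype.card F - 1) := by
    rw [← h3]
    convert h2 using 3
    simp
  have hc : (0 : ℝ) < ((Fintype.card F - 1 : ℕ) : ℝ) := by
    exact_mod_cast (show 0 < Fintype.card F - 1 by omega)
  have h2' : ((Fintype.card F : ℝ) ^ (k + 1) - 1) * Fintype.card F =
      (flats F (k + 1) k).ncard * ((Fintype.card F - 1 : ℕ) : ℝ) := by
    have h4 : 1 ≤ Fintype.card F ^ (k + 1) := Nat.one_le_pow _ _ (by omega)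
    have h5 := congrArg (Nat.cast (R := ℝ)) h2
    rw [Nat.cast_mul, Nat.cast_sub h4] at h5
    simpa using h5
  have h1' := congrArg (Nat.cast (R := ℝ)) h1
  rw [Nat.cast_mul] at h1'
  rw [h2', rejProb, ← mul_div_mul_right _ _ hc.ne', ← h1']
  congr!

theorem exists_bad [Fintype F] {p r k d : ℕ} (hp : p.Prime)
    (hF : Fintype.card F = p ^ r) (hd : d < k * (p ^ r - p ^ (r - 1)))
    {f : (Fin (k + 1) → F) → F} (hf : d < deg f) :
    ∃ l : Module.Dual F (Fin (k + 1) → F), l ≠ 0 ∧ ∃ b, d < degOn f (hyperplane l b : Set _) := by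
  classical
  have hq : 1 < Fintype.card F := Fintype.one_lt_card
  have hpos : 0 < (Fintype.card F - 1) * Fintype.card F ^ k :=
    Nat.mul_pos (by omega) (Nat.pow_pos (by omega))
  obtain ⟨⟨l, b⟩, hx⟩ := Finset.card_pos.1 (hpos.trans_le (card_transversal_single_ge hp hF hd hf))
  obtain ⟨-, h1, h2⟩ := Finset.mem_filter.1 hx
  refine ⟨l, fun h => h1 ?_, b, h2⟩
  rw [h, LinearMap.zero_apply]

/-- Since q > 1 forces r ≥ 1, the real number q - q/p is the integer p^r - p^(r-1), and the ceiling
condition becomes d + 1 ≤ k(q - q/p). -/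
theorem lt_mul_of_ceil_le {p q r d k : ℕ} (hp : p.Prime) (hq : q = p ^ r) (hq1 : 1 < q)
    (hk : ⌈((d : ℝ) + 1) / ((q : ℝ) - (q : ℝ) / (p : ℝ))⌉₊ ≤ k) :
    d < k * (p ^ r - p ^ (r - 1)) := by
  have hr : r ≠ 0 := by
    rintro rfl
    simp at hq
    omega
  obtain ⟨s, rfl⟩ := Nat.exists_eq_succ_of_ne_zero hr
  have hp0 : (p : ℝ) ≠ 0 := by exact_mod_cast hp.ne_zero
  have hlt : p ^ s < p ^ (s + 1) := Nat.pow_lt_pow_right hp.one_lt (Nat.lt_succ_self s)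
  have hcast : (q : ℝ) - (q : ℝ) / (p : ℝ) = ((p ^ (s + 1) - p ^ s : ℕ) : ℝ) := by
    rw [Nat.cast_sub hlt.le, hq]
    push_cast
    rw [pow_succ, mul_div_cancel_right₀ _ hp0]
  have hpos : (0 : ℝ) < ((p ^ (s + 1) - p ^ s : ℕ) : ℝ) := by
    exact_mod_cast Nat.sub_pos_of_lt hlt
  rw [hcast, Nat.ceil_le, div_le_iff₀ hpos] at hk
  exact_mod_cast hk

end FlatTest

theorem lemma6 {F : Type*} [Field F] [Fintype F] (p q r d t k : ℕ) (hp : p.Prime)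
    (hq : q = p ^ r) (hF : Fintype.card F = q)
    (ht : t = ⌈((d : ℝ) + 1) / ((q : ℝ) - (q : ℝ) / (p : ℝ))⌉₊) (hk : t ≤ k)
    (f : (Fin (k + 1) → F) → F) :
    (d < FlatTest.deg f → 1 / (q : ℝ) ≤ FlatTest.rejProb k d f) ∧
    (d < FlatTest.deg f → FlatTest.deg f < (k + 1) * (q - 1) →
      1 / (q : ℝ) < FlatTest.rejProb k d f) := by
  classical
  have hFr : Fintype.card F = p ^ r := hF.trans hq
  have hq1 : 1 < q := hF ▸ Fintype.one_lt_card
  have hd : d < k * (p ^ r - p ^ (r - 1)) := FlatTest.lt_mul_of_ceil_le hp hq hq1 (ht ▸ hk)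
  have hbad := fun (hf : d < FlatTest.deg f) (l : Module.Dual F (Fin (k + 1) → F)) (hl : l ≠ 0) =>
    FlatTest.card_bad_ge hp hFr hd hf hl
  have hrej := FlatTest.rejProb_eq (d := d) f
  rw [hF] at hbad hrej
  set B := Finset.card {x : Module.Dual F (Fin (k + 1) → F) × F | x.1 ≠ 0 ∧
    d < FlatTest.degOn f (FlatTest.hyperplane x.1 x.2 : Set (Fin (k + 1) → F))}
  have hqR : (1 : ℝ) < q := by exact_mod_cast hq1
  have hpow : (1 : ℝ) < (q : ℝ) ^ (k + 1) := one_lt_pow₀ hqR (by omega)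
  have hpos : (0 : ℝ) < (q : ℝ) ^ (k + 1) - 1 := by linarith
  have hone : 1 / (q : ℝ) = ((q : ℝ) ^ (k + 1) - 1) / (((q : ℝ) ^ (k + 1) - 1) * q) := by
    field_simp
  rw [hrej, hone]
  constructor
  · intro hf
    obtain ⟨l, hl, b, hb⟩ := FlatTest.exists_bad hp hFr hd hf
    have h1 := hbad hf l hl
    have h2 : 0 < Finset.card {b : F | d < FlatTest.degOn f (FlatTest.hyperplane l b : Set _)} :=
      Finset.card_pos.2 ⟨b, by simpa using hb⟩
    have h3 := Nat.mul_le_mul_left (q - 1) (Nat.succ_le_of_lt h2)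
    -- The one bad translate contributes q - 1 equations, reducing the deficit q to 1.
    have h4 : q ^ (k + 1) ≤ B + 1 := by omega
    have h5 : (q : ℝ) ^ (k + 1) ≤ B + 1 := by exact_mod_cast h4
    gcongr
    linarith
  · intro hf hf'
    obtain ⟨l, hl, b, b', hne, hb, hb'⟩ := FlatTest.exists_two hp hFr hd hf (by rwa [hF])
    have h1 := hbad hf l hl
    have h2 : 1 < Finset.card {b : F | d < FlatTest.degOn f (FlatTest.hyperplane l b : Set _)} :=
      Finset.one_lt_card.2 ⟨b', by simpa using hb', b, by simpa using hb, hne⟩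
    have h3 := Nat.mul_le_mul_left (q - 1) (Nat.succ_le_of_lt h2)
    -- Two bad translates contribute 2(q - 1) ≥ q equations, so the deficit q is fully covered.
    have h4 : q ^ (k + 1) < B + 1 := by omega
    have h5 : (q : ℝ) ^ (k + 1) < B + 1 := by exact_mod_cast h4
    gcongr
    linarith
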